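/- **Setting.** A signature $\Sigma=(S,F,L)$ consists of a set $S$ of sorts, a set $F$ of function symbols $\sigma:w\to s$ with $w\in S^*$ and $s\in S$, and a set $L$ of transition labels. A $\Sigma$-model $\mathfrak A$ consists of a (possibly empty) set $\mathfrak A_s$ for each sort $s$, a function $\sigma^{\mathfrak A}:\mathfrak A_{s_1}\times\dots\times\mathfrak A_{s_n}\to\mathfrak A_s$ for each $\sigma:s_1\dots s_n\to s$ in $F$, and a relation $\varrho^{\mathfrak A}_s\subseteq\mathfrak A_s\times\mathfrak A_s$ for each $\varrho\in L$ and $s\in S$. Actions are generated by $\mathfrak a ::= \varrho\mid \mathfrak a;\mathfrak a\mid\mathfrak a\cup\mathfrak a\mid\mathfrak a^*$ with $\varrho\in L$, and are interpreted in each carrier set as binary relations: composition, union, reflexive-transitive closure. The sentences of transition algebra over $\Sigma$ are generated by $$\phi ::= t=t'\mid \mathfrak a(t_1,t_2)\mid\neg\phi\mid\textstyle\bigvee\Phi\mid\exists X\cdot\phi',$$ where $t,t'$ and $t_1,t_2$ are ground $\Sigma$-terms of the same sort, $\Phi$ is a finite set of $\Sigma$-sentences, $X$ is a finite block of sorted variables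 with names from $\{v_i\mid i<\omega\}$ (no name being used with two sorts in one block), and $\phi'$ is a sentence over the signature $\Sigma[X]$ obtained by adding the elements of $X$ as new constants. Satisfaction is the usual one; $\mathfrak A\models\exists X\cdot\phi'$ iff some expansion of $\mathfrak A$ to $\Sigma[X]$ satisfies $\phi'$. Let $\mathcal L$ be transition algebra or, more generally, any fragment of it obtained by discarding some of the operators $\neg,\bigvee,;,\cup,{}^*$ (equations, transition rules for labels and existential quantification are kept). The power of $\Sigma$ is the cardinality of the set of $\Sigma$-sentences in $\mathcal L$. A submodel $\mathfrak B$ of $\mathfrak A$ is given by subsets $\mathfrak B_s\subseteq\mathfrak A_s$ closed under the operations of $\mathfrak A$, with the restricted operations and relations; it is elementary if $\mathfrak B$ and $\mathfrak A$ satisfy the same $\mathcal L$-sentences over the signature obtained from $\Sigma$ by adding every element of $\mathfrak B$ as a new constant denoting itself. **Theorem (Downward Löwenheim–Skolem).** Let $\mathfrak A$ be a model over a signature $\Sigma=(S,F,L)$ of power $\alpha$, and let $s\in S$ be a sort with $\mathrm{card}(\mathfrak A_s)\ge\alpha$. Then $\mathfrak A$ has an elementary submodel $\mathfrak B$ with $\mathrm{card}(\mathfrak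 B_s)=\alpha$. -/

import Mathlib

/-!
Many-sorted transition algebra. A signature `(S, F, L)` is given by a type `S` of sorts, a family
`F : List S → S → Type u` of function symbols (`F w s` is the set of symbols `σ : w → s`) and a
type `L` of transition labels.
-/

universe u

namespace TA

/-- The function symbols of `Σ[C]`: those of `Σ`, and the elements of the `S`-sorted set `C` as new
constants. -/
inductive ExtOp {S : Type u} (F : List S → S → Type u) (C : S → Type u) : List S → S → Type u
  | old {w : List S} {s : S} (σ : F w s) : ExtOp F C w s
  | const {s : S} (c : C s) : ExtOp F C [] s

/-- Ground terms over the signature. -/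
inductive Term {S : Type u} (F : List S → S → Type u) : S → Type u
  | app {w : List S} {s : S} (σ : F w s) (args : ∀ i : Fin w.length, Term F (w.get i)) : Term F s

/-- Models (transition algebras); carrier sets may be empty. -/
structure Model {S : Type u} (F : List S → S → Type u) (L : Type u) where
  carrier : S → Type u
  op : ∀ {w : List S} {s : S}, F w s → (∀ i : Fin w.length, carrier (w.get i)) → carrier s
  rel : L → ∀ s : S, carrier s → carrier s → Prop

/-- The expansion of `A` to `Σ[C]` that interprets the new constants by `v`. -/
def Model.expand {S : Type u} {F : List S → S → Type u} {L : Type u} (A : Model F L)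
    {C : S → Type u} (v : ∀ s : S, C s → A.carrier s) : Model (ExtOp F C) L where
  carrier := A.carrier
  op := fun f =>
    match f with
    | .old σ => A.op σ
    | .const c => fun _ => v _ c
  rel := A.rel

/-- The value of a ground term in a model. -/
def Term.eval {S : Type u} {F : List S → S → Type u} {L : Type u} (A : Model F L) :
    {s : S} → Term F s → A.carrier s
  | _, .app σ args => A.op σ (fun i => (args i).eval A)

/-- Actions. -/
inductive Action (L : Type u) : Type u
  | label (ρ : L) : Action L
  | seq (a b : Action L) : Action L
  | union (a b : Action L) : Action L
  | star (a : Action L) : Action L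

/-- The binary relation denoted by an action on the carrier of sort `s`. -/
def Action.interp {S : Type u} {F : List S → S → Type u} {L : Type u} (A : Model F L) (s : S) :
    Action L → A.carrier s → A.carrier s → Prop
  | .label ρ => A.rel ρ s
  | .seq a b => Relation.Comp (a.interp A s) (b.interp A s)
  | .union a b => fun x y => a.interp A s x y ∨ b.interp A s x y
  | .star a => Relation.ReflTransGen (a.interp A s)

/-- Finite blocks of variables: a variable is a pair of a name `i` (standing for `v_i`) and a sort,
and a block does not use the same name with two different sorts. -/
def Block (S : Type u) : Type u :=
  {X : Finset (ℕ × S) // ∀ x ∈ X, ∀ y ∈ X, x.2 ≠ y.2 → x.1 ≠ y.1}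

/-- The variables of sort `s` in a block. -/
def Block.vars {S : Type u} (X : Block S) (s : S) : Type u :=
  {x : ℕ × S // x ∈ X.1 ∧ x.2 = s}

/-- The function symbols of `Σ[Xₙ]⋯[X₁]`, for the list of blocks `[X₁, …, Xₙ]`. Variables of
different blocks are different constants, even when they have the same name and sort. -/
def extBlocks {S : Type u} (F : List S → S → Type u) : List (Block S) → List S → S → Type u
  | [] => F
  | X :: Γ => ExtOp (extBlocks F Γ) X.vars

/-- `Sen F L Γ` is the set of sentences over the extension of `(S, F, L)` with the variables of
the blocks in `Γ`. A finite disjunction is given by a finite family of sentences. -/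
inductive Sen {S : Type u} (F : List S → S → Type u) (L : Type u) : List (Block S) → Type u
  | eq {Γ : List (Block S)} {s : S} (t t' : Term (extBlocks F Γ) s) : Sen F L Γ
  | trans {Γ : List (Block S)} {s : S} (a : Action L) (t₁ t₂ : Term (extBlocks F Γ) s) :
      Sen F L Γ
  | neg {Γ : List (Block S)} (φ : Sen F L Γ) : Sen F L Γ
  | or {Γ : List (Block S)} {n : ℕ} (Φ : Fin n → Sen F L Γ) : Sen F L Γ
  | ex {Γ : List (Block S)} (X : Block S) (φ : Sen F L (X :: Γ)) : Sen F L Γ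

/-- Satisfaction of a sentence over an extension of `(S, F, L)` in a model of that extension. -/
def Sen.Sat {S : Type u} {F : List S → S → Type u} {L : Type u} :
    {Γ : List (Block S)} → Sen F L Γ → Model (extBlocks F Γ) L → Prop
  | _, .eq t t', A => t.eval A = t'.eval A
  | _, .trans (s := s) a t₁ t₂, A => a.interp A s (t₁.eval A) (t₂.eval A)
  | _, .neg φ, A => ¬ φ.Sat A
  | _, .or Φ, A => ∃ i, (Φ i).Sat A
  | _, .ex X φ, A => ∃ v : ∀ s : S, X.vars s → A.carrier s, φ.Sat (A.expand v)

/-- A fragment of transition algebra, given by the sentence operators and the action operators that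
it keeps. (Equations and transition rules for labels always remain.) Transition algebra itself is
the fragment that keeps all operators. -/
structure Fragment where
  neg : Prop
  or : Prop
  ex : Prop
  seq : Prop
  union : Prop
  star : Prop

/-- The action uses only operators of the fragment. -/
def Action.Mem {L : Type u} (𝓛 : Fragment) : Action L → Prop
  | .label _ => True
  | .seq a b => 𝓛.seq ∧ a.Mem 𝓛 ∧ b.Mem 𝓛
  | .union a b => 𝓛.union ∧ a.Mem 𝓛 ∧ b.Mem 𝓛
  | .star a => 𝓛.star ∧ a.Mem 𝓛

/-- The sentence uses only operators of the fragment. -/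
def Sen.Mem {S : Type u} {F : List S → S → Type u} {L : Type u} (𝓛 : Fragment) :
    {Γ : List (Block S)} → Sen F L Γ → Prop
  | _, .eq _ _ => True
  | _, .trans a _ _ => a.Mem 𝓛
  | _, .neg φ => 𝓛.neg ∧ φ.Mem 𝓛
  | _, .or Φ => 𝓛.or ∧ ∀ i, (Φ i).Mem 𝓛
  | _, .ex _ φ => 𝓛.ex ∧ φ.Mem 𝓛

/-- The power of a signature: the number of its sentences in the fragment. -/
noncomputable def power {S : Type u} (F : List S → S → Type u) (L : Type u) (𝓛 : Fragment) :
    Cardinal.{u} :=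
  Cardinal.mk {φ : Sen F L [] // φ.Mem 𝓛}

/-- Submodels: subsets of the carriers closed under the operations. -/
structure Submodel {S : Type u} {F : List S → S → Type u} {L : Type u} (A : Model F L) where
  carrier : ∀ s : S, Set (A.carrier s)
  closed : ∀ {w : List S} {s : S} (σ : F w s) (x : ∀ i : Fin w.length, A.carrier (w.get i)),
    (∀ i, x i ∈ carrier (w.get i)) → A.op σ x ∈ carrier s

/-- A submodel as a model, with the restricted operations and transition relations. -/
def Submodel.toModel {S : Type u} {F : List S → S → Type u} {L : Type u} {A : Model F L}
    (B : Submodel A) : Model F L where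
  carrier := fun s => B.carrier s
  op := fun σ x => ⟨A.op σ (fun i => (x i).1), B.closed σ _ (fun i => (x i).2)⟩
  rel := fun ρ s x y => A.rel ρ s x.1 y.1

/-- `B` is an elementary submodel of `A`: the two models satisfy the same sentences (of the
fragment) over the signature extended with all elements of `B` as constants, each of which denotes
itself. -/
def Submodel.IsElementary {S : Type u} {F : List S → S → Type u} {L : Type u} {A : Model F L}
    (B : Submodel A) (𝓛 : Fragment) : Prop :=
  ∀ φ : Sen (ExtOp F (fun s => B.carrier s)) L [], φ.Mem 𝓛 →
    (φ.Sat (B.toModel.expand (fun _ b => b)) ↔ φ.Sat (A.expand (fun _ b => b.1)))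

end TA

namespace TA

/-! ### One-sorted structures from many-sorted models. -/

open FirstOrder FirstOrder.Language

variable {S : Type u} {F : List S → S → Type u} {L : Type u}

/-! The idea is to reduce to the downward Löwenheim–Skolem theorem of one-sorted first-order logic.
The disjoint union of the carriers becomes a structure with a predicate for each sort and a binary
symbol for each action, compound ones included. So `a*`, which is not first-order definable, is
atomic, and every sentence translates to a first-order formula with quantifiers bounded by sorts
(`Sen.realize_toFormula`).

An elementary substructure `H` preserves the action symbols as inherited relations, whereas a
submodel recomputes compound actions from its labels. The two agree (`interp_submodelOf_iff`):
elementarity supplies the midpoint of a composition, and a pair related by `a*` is either equal or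
related by some finite composition `a;…;a`, itself an action.

The language has at most `α` symbols, because each function symbol, sort and label is recoverable
from a sentence built with `∃` and an atom, and `α` is infinite thanks to the variable names.
Starting from `α` elements of sort `s` and taking `H` of size `α` gives exactly `α` elements of sort
`s`. -/

/-- The elements of all carriers of a model, each together with its sort. -/
abbrev Model.Total (A : Model F L) : Type u := Σ s : S, A.carrier s

/-- The function symbols of the one-sorted language, indexed by their arity. -/
inductive OpSym (F : List S → S → Type u) : ℕ → Type u
  | mk {w : List S} {s : S} (σ : F w s) : OpSym F w.length

/-- The relation symbols of the one-sorted language: a unary one for each sort and a binary one for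
each action. -/
inductive RelSym (S L : Type u) : ℕ → Type u
  | sort (s : S) : RelSym S L 1
  | act (a : Action L) : RelSym S L 2

/-- The one-sorted first-order language of a signature. -/
def lang (F : List S → S → Type u) (L : Type u) : FirstOrder.Language.{u, u} where
  Functions := OpSym F
  Relations := RelSym S L

open Classical in
/-- The operation of a model on sorted elements. Ill-sorted arguments give one of the arguments of
a wrong sort. -/
noncomputable def Model.totalOp (A : Model F L) {w : List S} {s : S} (σ : F w s)
    (x : Fin w.length → A.Total) : A.Total :=
  -- A fixed default might be missing (carriers may be empty) or lie outside a submodel; an argument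
  -- never does.
  if h : ∃ i, (x i).1 ≠ w.get i then x h.choose
  else ⟨s, A.op σ fun i => (not_not.1 fun hi => h ⟨i, hi⟩ : (x i).1 = w.get i) ▸ (x i).2⟩

noncomputable instance Model.totalStructure (A : Model F L) : (lang F L).Structure A.Total where
  funMap f := match f with
    | .mk σ => A.totalOp σ
  RelMap r := match r with
    | .sort s => fun x => (x 0).1 = s
    | .act a => fun x => ∃ (s : S) (p q : A.carrier s), x 0 = ⟨s, p⟩ ∧ x 1 = ⟨s, q⟩ ∧
        a.interp A s p q

theorem Model.totalOp_mk (A : Model F L) {w : List S} {s : S} (σ : F w s)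
    (x : ∀ i : Fin w.length, A.carrier (w.get i)) :
    A.totalOp σ (fun i => ⟨w.get i, x i⟩) = ⟨s, A.op σ x⟩ := by
  simp [totalOp]

theorem Model.totalOp_map (A B : Model F L) (e : ∀ s, A.carrier s → B.carrier s) {w : List S}
    {s : S} (σ : F w s) (he : ∀ x, e s (A.op σ x) = B.op σ fun i => e _ (x i))
    (x : Fin w.length → A.Total) :
    Sigma.map id e (A.totalOp σ x) = B.totalOp σ (Sigma.map id e ∘ x) := by
  by_cases h : ∃ i, (x i).1 ≠ w.get i
  · have h' : ∃ i, ((Sigma.map id e ∘ x) i).1 ≠ w.get i := h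
    rw [totalOp, totalOp, dif_pos h, dif_pos h']
    -- Sorts are unchanged by the map, so both sides choose the same index from the same
    -- proposition.
    rfl
  · have hy : ∀ i, ∃ y : A.carrier (w.get i), (⟨w.get i, y⟩ : A.Total) = x i := by
      intro i
      have hi : (x i).1 = w.get i := not_not.1 fun hi => h ⟨i, hi⟩
      generalize x i = y at hi
      obtain ⟨s, y⟩ := y
      cases hi
      exact ⟨y, rfl⟩
    choose y hy using hy
    obtain rfl : (fun i => (⟨w.get i, y i⟩ : A.Total)) = x := funext hy
    rw [totalOp_mk]
    refine Eq.trans ?_ (B.totalOp_mk σ fun i => e _ (y i)).symm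
    rw [← he]
    rfl

/-- The symbol of an action. -/
def actSym (F : List S → S → Type u) (a : Action L) : (lang F L).Relations 2 := RelSym.act a

/-- The symbol of a sort. -/
def sortSym (F : List S → S → Type u) (L : Type u) (s : S) : (lang F L).Relations 1 :=
  RelSym.sort s

/-- The symbol of an operation. -/
def opSym (L : Type u) {w : List S} {s : S} (σ : F w s) : (lang F L).Functions w.length :=
  OpSym.mk σ

theorem Model.funMap_opSym (A : Model F L) {w : List S} {s : S} (σ : F w s)
    (x : Fin w.length → A.Total) : Structure.funMap (opSym L σ) x = A.totalOp σ x := rfl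

theorem Model.relMap_sortSym (A : Model F L) (s : S) (x : Fin 1 → A.Total) :
    Structure.RelMap (sortSym F L s) x ↔ (x 0).1 = s := Iff.rfl

theorem Model.relMap_actSym (A : Model F L) (a : Action L) (x : Fin 2 → A.Total) :
    Structure.RelMap (actSym F a) x ↔ ∃ (s : S) (p q : A.carrier s), x 0 = ⟨s, p⟩ ∧ x 1 = ⟨s, q⟩ ∧
        a.interp A s p q := Iff.rfl

theorem Model.relMap_actSym_mk (A : Model F L) (a : Action L) {s : S} (p q : A.carrier s) :
    Structure.RelMap (actSym F a) ![(⟨s, p⟩ : A.Total), ⟨s, q⟩] ↔ a.interp A s p q := by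
  rw [relMap_actSym]
  constructor
  · rintro ⟨s', p', q', h1, h2, h⟩
    simp only [Matrix.cons_val_zero, Matrix.cons_val_one] at h1 h2
    cases h1
    cases h2
    exact h
  · exact fun h => ⟨s, p, q, rfl, rfl, h⟩

/-! ### Reducts along maps of function symbols -/

/-- The reduct of a model along a map of function symbols. -/
def Model.reduct {G G' : List S → S → Type u} (τ : ∀ w s, G w s → G' w s) (A : Model G' L) :
    Model G L where
  carrier := A.carrier
  op g := A.op (τ _ _ g)
  rel := A.rel

theorem Action.interp_reduct {G G' : List S → S → Type u} (τ : ∀ w s, G w s → G' w s)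
    (A : Model G' L) (a : Action L) (s : S) : a.interp (A.reduct τ) s = a.interp A s := by
  induction a with
  | label ρ => rfl
  | seq a b iha ihb => simp only [interp, iha, ihb]; rfl
  | union a b iha ihb => simp only [interp, iha, ihb]; rfl
  | star a ih => simp only [interp, ih]; rfl

theorem Action.interp_expand (A : Model F L) {C : S → Type u} (v : ∀ s, C s → A.carrier s)
    (a : Action L) (s : S) : a.interp (A.expand v) s = a.interp A s := by
  induction a with
  | label ρ => rfl
  | seq a b iha ihb => simp only [interp, iha, ihb]; rfl
  | union a b iha ihb => simp only [interp, iha, ihb]; rfl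
  | star a ih => simp only [interp, ih]; rfl

/-- The constants of a signature with constants `C`, extended with a list of blocks. -/
def consts (C : S → Type u) : List (Block S) → S → Type u
  | [], s => C s
  | X :: Γ, s => consts C Γ s ⊕ X.vars s

/-- The function symbols of the extension with `C` and then with a list of blocks, as symbols of
the extension with all these constants at once. -/
def flat (C : S → Type u) : ∀ (Γ : List (Block S)) (w : List S) (s : S),
    extBlocks (ExtOp F C) Γ w s → ExtOp F (consts C Γ) w s
  | [], _, _, f => f
  | X :: Γ, _, _, .old f =>
    match flat C Γ _ _ f with
    | .old σ => .old σ
    | .const c => .const (C := consts C (X :: Γ)) (Sum.inl c)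
  | X :: Γ, _, _, .const x => .const (C := consts C (X :: Γ)) (Sum.inr x)

/-- Satisfaction adds blocks one at a time, the translation interprets all constants at once; this
is the quantifier step that reconciles them. -/
theorem Model.reduct_flat_expand (A : Model F L) {C : S → Type u} (X : Block S)
    (Γ : List (Block S)) (d : ∀ s, consts C Γ s → A.carrier s)
    (v : ∀ s, X.vars s → A.carrier s) :
    ((A.expand d).reduct (flat C Γ)).expand v =
      Model.reduct (flat C (X :: Γ))
        (A.expand (C := consts C (X :: Γ)) fun s => Sum.elim (d s) (v s)) := by
  simp only [Model.reduct, Model.expand]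
  congr 1
  funext w s f
  cases f with
  | const x => rfl
  | old f =>
    simp only [flat]
    generalize flat C Γ w s f = g
    cases g <;> rfl

/-! ### Translation to one-sorted first-order logic -/

/-- The term given by a function symbol or a constant. -/
def ExtOp.toTerm (L : Type u) {D : S → Type u} : ∀ {w : List S} {s : S}, ExtOp F D w s →
    (Fin w.length → (lang F L).Term (Σ s, D s)) → (lang F L).Term (Σ s, D s)
  | _, _, .old σ, ts => .func (opSym L σ) ts
  | _, s, .const c, _ => .var ⟨s, c⟩

/-- The translation of ground terms to terms whose variables are the constants. -/
def Term.toTerm (L : Type u) {G : List S → S → Type u} {D : S → Type u}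
    (τ : ∀ w s, G w s → ExtOp F D w s) : ∀ {s : S}, Term G s → (lang F L).Term (Σ s, D s)
  | _, .app g ts => (τ _ _ g).toTerm L fun i => (ts i).toTerm L τ

/-- The assignment of sorted elements to constants. -/
def Model.assign (A : Model F L) {D : S → Type u} (d : ∀ s, D s → A.carrier s) :
    (Σ s, D s) → A.Total := fun x => ⟨x.1, d x.1 x.2⟩

theorem Term.realize_toTerm (A : Model F L) {G : List S → S → Type u} {D : S → Type u}
    (τ : ∀ w s, G w s → ExtOp F D w s) (d : ∀ s, D s → A.carrier s) {s : S} (t : Term G s) :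
    (t.toTerm L τ).realize (A.assign d) = ⟨s, t.eval ((A.expand d).reduct τ)⟩ := by
  induction t with
  | @app w s g ts ih =>
    simp only [toTerm, eval, Model.reduct]
    generalize τ w s g = h
    cases h with
    | old σ =>
      simp only [ExtOp.toTerm, FirstOrder.Language.Term.realize, ih, Model.funMap_opSym]
      exact A.totalOp_mk σ _
    | const c => rfl

instance Block.finite_vars (X : Block S) : Finite (Σ s, X.vars s) :=
  Finite.of_injective (β := X.1) (fun x => ⟨x.2.1, x.2.2.1⟩) (by
    rintro ⟨s, x, hx, rfl⟩ ⟨s', x', hx', rfl⟩ h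
    obtain rfl : x = x' := congrArg Subtype.val h
    rfl)

/-- Separates the constants of the last block. -/
def splitConsts (C : S → Type u) (X : Block S) (Γ : List (Block S)) :
    (Σ s, consts C (X :: Γ) s) → (Σ s, consts C Γ s) ⊕ (Σ s, X.vars s)
  | ⟨s, .inl c⟩ => .inl ⟨s, c⟩
  | ⟨s, .inr x⟩ => .inr ⟨s, x⟩

/-- The translation of sentences to first-order formulas. -/
noncomputable def Sen.toFormula {C : S → Type u} : ∀ {Γ : List (Block S)},
    Sen (ExtOp F C) L Γ → (lang F L).Formula (Σ s, consts C Γ s)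
  | Γ, .eq t t' => (t.toTerm L (flat C Γ)).equal (t'.toTerm L (flat C Γ))
  | Γ, .trans a t t' => (actSym F a).formula₂ (t.toTerm L (flat C Γ)) (t'.toTerm L (flat C Γ))
  | _, .neg φ => φ.toFormula.not
  | _, .or Φ => Formula.iSup fun i => (Φ i).toFormula
  | Γ, .ex X φ => Formula.iExs (Σ s, X.vars s)
      (Formula.iInf (fun x : Σ s, X.vars s => (sortSym F L x.1).formula₁ (.var (.inr x))) ⊓
        φ.toFormula.relabel (splitConsts C X Γ))

theorem Model.exists_assign (A : Model F L) {D : S → Type u} (i : (Σ s, D s) → A.Total)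
    (h : ∀ x, (i x).1 = x.1) : ∃ d : ∀ s, D s → A.carrier s, A.assign d = i := by
  have hy : ∀ (s : S) (x : D s), ∃ y : A.carrier s, (⟨s, y⟩ : A.Total) = i ⟨s, x⟩ := by
    intro s x
    have hx := h ⟨s, x⟩
    generalize i ⟨s, x⟩ = y at hx
    obtain ⟨s', y⟩ := y
    cases hx
    exact ⟨y, rfl⟩
  choose d hd using hy
  exact ⟨d, funext fun ⟨s, x⟩ => hd s x⟩

/-- The sort guards make the one-sorted witnesses of a block exactly the sorted valuations of its
variables, hence the expansions of the model. -/
theorem Sen.realize_toFormula (A : Model F L) {C : S → Type u} {Γ : List (Block S)}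
    (φ : Sen (ExtOp F C) L Γ) (d : ∀ s, consts C Γ s → A.carrier s) :
    φ.toFormula.Realize (A.assign d) ↔ φ.Sat ((A.expand d).reduct (flat C Γ)) := by
  induction φ with
  | eq t t' => 
    simp only [toFormula, Sat, Formula.realize_equal, Term.realize_toTerm]
    exact sigma_mk_injective.eq_iff
  | trans a t t' =>
    simp only [toFormula, Sat, Formula.realize_rel₂, Term.realize_toTerm, Action.interp_reduct,
      Action.interp_expand]
    exact A.relMap_actSym_mk a _ _
  | neg φ ih => simp [toFormula, Sat, ih]
  | or Φ ih => simp [toFormula, Sat, ih]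
  | @ex Γ X φ ih =>
    have key : ∀ v : ∀ s, X.vars s → A.carrier s,
        Sum.elim (A.assign d) (A.assign v) ∘ splitConsts C X Γ =
          A.assign (D := consts C (X :: Γ)) fun s => Sum.elim (d s) (v s) := by
      intro v
      funext ⟨s, x⟩
      cases x <;> rfl
    simp only [toFormula, Sat, Formula.realize_iExs, Formula.realize_inf, Formula.realize_iInf,
      Formula.realize_relabel, Formula.realize_rel₁, A.relMap_sortSym]
    constructor
    · rintro ⟨i, hi, h⟩
      obtain ⟨v, rfl⟩ := A.exists_assign i hi
      rw [key] at h
      exact ⟨v, A.reduct_flat_expand X Γ d v ▸ (ih _).1 h⟩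
    · rintro ⟨v, h⟩
      refine ⟨A.assign (D := X.vars) v, fun _ => rfl, ?_⟩
      refine (key v).symm ▸ (ih _).2 ?_
      exact A.reduct_flat_expand X Γ d v ▸ h

theorem Sen.realize_toFormula_nil (A : Model F L) {C : S → Type u}
    (φ : Sen (ExtOp F C) L []) (d : ∀ s, C s → A.carrier s) :
    φ.toFormula.Realize (A.assign (D := consts C []) d) ↔ φ.Sat (A.expand d) :=
  φ.realize_toFormula A d

/-- The composition of `n + 1` copies of an action. -/
def Action.iter (a : Action L) : ℕ → Action L
  | 0 => a
  | n + 1 => .seq (a.iter n) a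

theorem Action.exists_interp_iter (A : Model F L) (a : Action L) {s : S} {x y : A.carrier s}
    (h : Relation.TransGen (a.interp A s) x y) : ∃ n, (a.iter n).interp A s x y := by
  induction h with
  | single h => exact ⟨0, h⟩
  | tail _ h ih =>
    obtain ⟨n, hn⟩ := ih
    exact ⟨n + 1, _, hn, h⟩

/-! ### Submodels given by elementary substructures -/

/-- The submodel given by a substructure of the one-sorted structure. -/
def submodelOf {A : Model F L} (H : (lang F L).Substructure A.Total) : Submodel A where
  carrier s := {x | (⟨s, x⟩ : A.Total) ∈ H}
  closed σ x hx := by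
    have := H.fun_mem (opSym L σ) (fun i => ⟨_, x i⟩) hx
    rwa [A.funMap_opSym, A.totalOp_mk] at this

/-- Going down to the submodel needs intermediate points inside it: `hseq` provides them for
compositions, and star reduces to iterated compositions. -/
theorem interp_submodelOf_iff {A : Model F L} (H : (lang F L).ElementarySubstructure A.Total)
    (a : Action L) (s : S) (x y : (submodelOf H.toSubstructure).carrier s) :
    a.interp (submodelOf H.toSubstructure).toModel s x y ↔ a.interp A s x.1 y.1 := by
  have hseq : ∀ (a b : Action L) (x y : (submodelOf H.toSubstructure).carrier s) (z : A.carrier s),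
      a.interp A s x.1 z → b.interp A s z y.1 →
      ∃ z : (submodelOf H.toSubstructure).carrier s, a.interp A s x.1 z.1 ∧ b.interp A s z.1 y.1 := by
    intro a b x y z hxz hzy
    -- The formula `∃ z, a(x, z) ∧ b(z, y)` reflects from the model to `H`.
    let ψ : (lang F L).Formula (Fin 2) := Formula.iExs Unit
      ((actSym F a).formula₂ (.var (.inl 0)) (.var (.inr ())) ⊓
        (actSym F b).formula₂ (.var (.inr ())) (.var (.inl 1)))
    have h : ψ.Realize (![⟨s, x.1⟩, ⟨s, y.1⟩] : Fin 2 → A.Total) := by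
      simp only [ψ, Formula.realize_iExs, Formula.realize_inf, Formula.realize_rel₂]
      exact ⟨fun _ => ⟨s, z⟩, (A.relMap_actSym_mk a _ _).2 hxz, (A.relMap_actSym_mk b _ _).2 hzy⟩
    have hv : (![⟨s, x.1⟩, ⟨s, y.1⟩] : Fin 2 → A.Total) =
        H.subtype ∘ (![⟨⟨s, x.1⟩, x.2⟩, ⟨⟨s, y.1⟩, y.2⟩] : Fin 2 → H) := by
      funext i
      fin_cases i <;> rfl
    rw [hv, H.subtype.map_formula] at h
    simp only [ψ, Formula.realize_iExs, Formula.realize_inf, Formula.realize_rel₂,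
      ← H.subtype.map_rel] at h
    obtain ⟨i, h1, h2⟩ := h
    obtain ⟨s1, p1, q1, e1, e1', h1⟩ := (A.relMap_actSym a _).1 h1
    obtain ⟨s2, p2, q2, e2, e2', h2⟩ := (A.relMap_actSym b _).1 h2
    -- Action symbols relate only elements of equal sort, so the witness found in `H` has sort `s`.
    simp at e1 e1' e2 e2'
    obtain ⟨rfl, e1⟩ := e1
    cases e1
    obtain ⟨rfl, e2'⟩ := e2'
    cases e2'
    have hz := (i ()).2
    rw [e1'] at e2 hz
    cases e2
    exact ⟨⟨q1, hz⟩, h1, h2⟩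
  induction a generalizing x y with
  | label ρ => rfl
  | seq a b iha ihb =>
    constructor
    · rintro ⟨z, h1, h2⟩
      exact ⟨z.1, (iha x z).1 h1, (ihb z y).1 h2⟩
    · rintro ⟨z, h1, h2⟩
      obtain ⟨z, h1, h2⟩ := hseq a b x y z h1 h2
      exact ⟨z, (iha x z).2 h1, (ihb z y).2 h2⟩
  | union a b iha ihb => exact or_congr (iha x y) (ihb x y)
  | star a ih =>
    constructor
    · intro h
      change Relation.ReflTransGen (a.interp (submodelOf H.toSubstructure).toModel s) _ _ at h
      induction h with
      | refl => exact .refl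
      | tail _ h ih' => exact .tail ih' ((ih _ _).1 h)
    · intro h
      obtain ⟨x, hx⟩ := x
      obtain ⟨y, hy⟩ := y
      change Relation.ReflTransGen (a.interp (submodelOf H.toSubstructure).toModel s) _ _
      rcases Relation.reflTransGen_iff_eq_or_transGen.1 h with h' | h'
      · dsimp only at h'
        subst h'
        exact .refl
      · clear h
        obtain ⟨n, hn⟩ := a.exists_interp_iter A h'
        clear h'
        dsimp only at hn
        induction n generalizing y with
        | zero => exact .single ((ih _ _).2 hn)
        | succ n ihn =>
          obtain ⟨z, h1, h2⟩ := hn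
          -- The new midpoint may differ from the old one, but it is still reached from `x` by
          -- `a.iter n`, so induction applies to it.
          obtain ⟨⟨z, hz⟩, h1, h2⟩ := hseq _ _ ⟨x, hx⟩ ⟨y, hy⟩ z h1 h2
          exact .tail (ihn z hz h1) ((ih _ _).2 h2)

/-- The one-sorted structure of the submodel given by an elementary substructure is that
substructure. -/
noncomputable def totalEquiv {A : Model F L} (H : (lang F L).ElementarySubstructure A.Total) :
    (submodelOf H.toSubstructure).toModel.Total ≃[lang F L] H where
  toFun x := ⟨⟨x.1, x.2.1⟩, x.2.2⟩
  invFun y := ⟨y.1.1, y.1.2, y.2⟩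
  left_inv _ := rfl
  right_inv _ := rfl
  map_fun' f x := by
    obtain ⟨σ⟩ := f
    exact Subtype.ext ((submodelOf H.toSubstructure).toModel.totalOp_map A
      (fun _ => Subtype.val) σ (fun _ => rfl) x)
  map_rel' r x := by
    cases r with
    | sort s => rfl
    | act a =>
      change Structure.RelMap (actSym F a) (fun i => (⟨(x i).1, (x i).2.1⟩ : A.Total)) ↔
        Structure.RelMap (actSym F a) x
      constructor
      · intro h
        obtain ⟨s, p, q, h0, h1, h⟩ := (A.relMap_actSym a _).1 h
        have hp : (⟨s, p⟩ : A.Total) ∈ H := h0 ▸ (x 0).2.2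
        have hq : (⟨s, q⟩ : A.Total) ∈ H := h1 ▸ (x 1).2.2
        have inj : ∀ x y : (submodelOf H.toSubstructure).toModel.Total,
            (⟨x.1, x.2.1⟩ : A.Total) = ⟨y.1, y.2.1⟩ → x = y := by
          rintro ⟨s, x, hx⟩ ⟨s', x', hx'⟩ h
          cases h
          rfl
        exact ⟨s, ⟨p, hp⟩, ⟨q, hq⟩, inj _ _ h0, inj _ _ h1, (interp_submodelOf_iff H a s _ _).2 h⟩
      · rintro ⟨s, p, q, h0, h1, h⟩
        refine (A.relMap_actSym a _).2 ⟨s, p.1, q.1, ?_, ?_, (interp_submodelOf_iff H a s _ _).1 h⟩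
        · exact congrArg (Sigma.map id fun _ => Subtype.val) h0
        · exact congrArg (Sigma.map id fun _ => Subtype.val) h1

/-- The constants naming elements of the submodel become free variables assigned to themselves;
truth then passes through `totalEquiv` and the elementary inclusion. -/
theorem isElementary_submodelOf {A : Model F L}
    (H : (lang F L).ElementarySubstructure A.Total) (𝓛 : Fragment) :
    (submodelOf H.toSubstructure).IsElementary 𝓛 := by
  intro φ _
  let v : (Σ s, consts (fun s => (submodelOf H.toSubstructure).carrier s) [] s) →
    (submodelOf H.toSubstructure).toModel.Total := fun x => x
  refine (φ.realize_toFormula_nil (submodelOf H.toSubstructure).toModel _).symm.trans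
    (Iff.trans ?_ (φ.realize_toFormula_nil A _))
  exact ((totalEquiv H).toElementaryEmbedding.map_formula φ.toFormula v).symm.trans
    (H.subtype.map_formula φ.toFormula (totalEquiv H ∘ v)).symm

open Cardinal

/-! ### Cardinalities -/

/-- The shapes of the nodes of an action. -/
abbrev ActionNode (L : Type u) : Type u := L ⊕ ULift.{u} (Fin 3)

/-- The arity of a node of an action. -/
def ActionNode.Arity : ActionNode L → Type
  | .inl _ => Fin 0
  | .inr ⟨0⟩ => Fin 2
  | .inr ⟨1⟩ => Fin 2
  | .inr ⟨2⟩ => Fin 1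

instance (x : ActionNode L) : Finite x.Arity := by
  rcases x with x | ⟨x⟩
  · exact inferInstanceAs (Finite (Fin 0))
  · fin_cases x
    · exact inferInstanceAs (Finite (Fin 2))
    · exact inferInstanceAs (Finite (Fin 2))
    · exact inferInstanceAs (Finite (Fin 1))

/-- Actions as well-founded trees. -/
def Action.toW : Action L → WType (ActionNode.Arity (L := L))
  | .label ρ => ⟨.inl ρ, Fin.elim0⟩
  | .seq a b => ⟨.inr ⟨0⟩, (![a.toW, b.toW] : Fin 2 → _)⟩
  | .union a b => ⟨.inr ⟨1⟩, (![a.toW, b.toW] : Fin 2 → _)⟩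
  | .star a => ⟨.inr ⟨2⟩, (![a.toW] : Fin 1 → _)⟩

theorem Action.toW_injective : Function.Injective (Action.toW (L := L)) := by
  intro a
  induction a with
  | label ρ =>
    intro b h
    cases b <;> injection h with h1 h2 <;> simp at h1
    rw [h1]
  | seq a a' ih ih' =>
    intro b h
    cases b <;> injection h with h1 h2 <;> simp at h1
    rw [ih (congrFun h2 (0 : Fin 2)), ih' (congrFun h2 (1 : Fin 2))]
  | union a a' ih ih' =>
    intro b h
    cases b <;> injection h with h1 h2 <;> simp at h1
    rw [ih (congrFun h2 (0 : Fin 2)), ih' (congrFun h2 (1 : Fin 2))]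
  | star a ih =>
    intro b h
    cases b <;> injection h with h1 h2 <;> simp at h1
    rw [ih (congrFun h2 (0 : Fin 1))]

/-- Actions are finitely branching well-founded trees whose nodes are labels or one of three
operators. -/
theorem Action.mk_le : #(Action L) ≤ max #L ℵ₀ := by
  refine (mk_le_of_injective Action.toW_injective).trans
    (WType.cardinalMk_le_max_aleph0_of_finite'.trans ?_)
  rw [lift_uzero, mk_sum, lift_id, lift_id]
  refine max_le ((add_le_max _ _).trans (max_le (max_le (le_max_left _ _) ?_) (le_max_right _ _)))
    (le_max_right _ _)
  exact (mk_le_aleph0).trans (le_max_right _ _)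

/-! ### Sentences that encode the symbols of a signature. -/

/-- The block with the variables `v_i : w_i`. -/
def listBlock (w : List S) : Block S :=
  ⟨Finset.univ.map ⟨fun i : Fin w.length => ((i : ℕ), w.get i), fun i j h =>
    Fin.ext (Prod.ext_iff.1 h).1⟩, by
    simp only [Finset.mem_map, Finset.mem_univ, true_and]
    rintro _ ⟨i, rfl⟩ _ ⟨j, rfl⟩ h hij
    obtain rfl : i = j := Fin.ext hij
    exact h rfl⟩

/-- The term `v_i` over the extension with `listBlock w`. -/
def listVar (F : List S → S → Type u) (w : List S) (i : Fin w.length) :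
    Term (extBlocks F [listBlock w]) (w.get i) :=
  .app (w := []) (.const ⟨(i, w.get i), by simp [listBlock], rfl⟩) fun i => i.elim0

/-- The sentence `∃ v₀ … vₙ₋₁ · σ(v₀, …, vₙ₋₁) = σ(v₀, …, vₙ₋₁)`. -/
def opSen (L : Type u) {w : List S} {s : S} (σ : F w s) : Sen F L [] :=
  .ex (listBlock w) (.eq (s := s) (.app (.old σ) (listVar F w)) (.app (.old σ) (listVar F w)))

/-- The block with the variable `v_n : s`. -/
def varBlock (n : ℕ) (s : S) : Block S := ⟨{(n, s)}, by simp⟩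

/-- The term `v_n` over the extension with `varBlock n s`. -/
def varTerm (F : List S → S → Type u) (n : ℕ) (s : S) :
    Term (extBlocks F [varBlock n s]) s :=
  .app (w := []) (.const ⟨(n, s), by simp [varBlock], rfl⟩) fun i => i.elim0

/-- The sentence `∃ v_n · v_n = v_n`. -/
def sortSen (F : List S → S → Type u) (L : Type u) (n : ℕ) (s : S) : Sen F L [] :=
  .ex (varBlock n s) (.eq (varTerm F n s) (varTerm F n s))

/-- The sentence `∃ v₀ · ρ(v₀, v₀)`. -/
def labelSen (F : List S → S → Type u) (s : S) (ρ : L) : Sen F L [] :=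
  .ex (varBlock 0 s) (.trans (.label ρ) (varTerm F 0 s) (varTerm F 0 s))

theorem varBlock_injective {n n' : ℕ} {s s' : S} (h : varBlock n s = varBlock n' s') :
    n = n' ∧ s = s' := by
  exact Prod.ext_iff.1 (Finset.singleton_injective (congrArg Subtype.val h))

/-- `opSen` determines `w`, `s` and `σ`. Quantified variables serve as arguments because the
signature may have no ground terms. -/
theorem mk_ops_le_power (F : List S → S → Type u) (L : Type u) (𝓛 : Fragment) (h𝓛 : 𝓛.ex) :
    #(Σ (w : List S) (s : S), F w s) ≤ power F L 𝓛 := by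
  refine mk_le_of_injective
    (f := fun x => ⟨opSen L x.2.2, h𝓛, trivial⟩) ?_
  rintro ⟨w, s, σ⟩ ⟨w', s', σ'⟩ h
  have h := congrArg Subtype.val h
  simp only [opSen, Sen.ex.injEq] at h
  obtain ⟨hX, h⟩ := h
  -- The blocks are generalised to variables: `listBlock w = listBlock w'` cannot be substituted
  -- while `w` and `w'` are unidentified.
  have aux : ∀ (X X' : Block S) (hX : X = X') (t : Term (extBlocks F [X]) s)
      (t' : Term (extBlocks F [X']) s'), HEq (Sen.eq (L := L) (Γ := [X]) t t)
        (Sen.eq (L := L) (Γ := [X']) t' t') → s = s' ∧ HEq t t' := by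
    rintro X _ rfl t t' h
    have h := eq_of_heq h
    exact ⟨(Sen.eq.inj h).1, (Sen.eq.inj h).2.1⟩
  obtain ⟨rfl, h⟩ := aux _ _ hX _ _ h
  have aux : ∀ (X X' : Block S) (hX : X = X') (x y),
      HEq (Term.app (F := extBlocks F [X]) (w := w) (s := s) (.old σ) x)
        (Term.app (F := extBlocks F [X']) (w := w') (s := s) (.old σ') y) →
      w = w' ∧ HEq σ σ' := by
    rintro X _ rfl x y h
    have h := eq_of_heq h
    obtain ⟨rfl, h, -⟩ := Term.app.inj h
    exact ⟨rfl, heq_of_eq (ExtOp.old.inj (eq_of_heq h))⟩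
  obtain ⟨rfl, h⟩ := aux _ _ hX _ _ h
  cases h
  rfl

theorem mk_nat_prod_sorts_le_power (F : List S → S → Type u) (L : Type u) (𝓛 : Fragment)
    (h𝓛 : 𝓛.ex) : #(ULift.{u} ℕ × S) ≤ power F L 𝓛 := by
  refine mk_le_of_injective (f := fun x => ⟨sortSen F L x.1.down x.2, h𝓛, trivial⟩) ?_
  rintro ⟨⟨n⟩, s⟩ ⟨⟨n'⟩, s'⟩ h
  have h := congrArg Subtype.val h
  simp only [sortSen, Sen.ex.injEq] at h
  obtain ⟨rfl, rfl⟩ := varBlock_injective h.1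
  rfl

/-- Some sort is needed: without sorts there are no terms, hence no transition rules. -/
theorem mk_labels_le_power (F : List S → S → Type u) (L : Type u) (𝓛 : Fragment) (h𝓛 : 𝓛.ex)
    (s : S) : #L ≤ power F L 𝓛 := by
  refine mk_le_of_injective (f := fun ρ => ⟨labelSen F s ρ, h𝓛, trivial⟩) ?_
  intro ρ ρ' h
  simpa [labelSen] using h

theorem aleph0_le_power (F : List S → S → Type u) (L : Type u) (𝓛 : Fragment) (h𝓛 : 𝓛.ex)
    (s : S) : ℵ₀ ≤ power F L 𝓛 := by
  have : Nonempty S := ⟨s⟩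
  exact (aleph0_le_mk (ULift.{u} ℕ × S)).trans (mk_nat_prod_sorts_le_power F L 𝓛 h𝓛)

theorem mk_sorts_le_power (F : List S → S → Type u) (L : Type u) (𝓛 : Fragment) (h𝓛 : 𝓛.ex) :
    #S ≤ power F L 𝓛 :=
  (mk_le_of_surjective Prod.snd_surjective).trans (mk_nat_prod_sorts_le_power F L 𝓛 h𝓛)

theorem card_lang_le_power (F : List S → S → Type u) (L : Type u) (𝓛 : Fragment) (h𝓛 : 𝓛.ex)
    (s : S) : (lang F L).card ≤ power F L 𝓛 := by
  have h0 := aleph0_le_power F L 𝓛 h𝓛 s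
  rw [FirstOrder.Language.card, mk_sum, lift_id, lift_id]
  refine add_le_of_le h0 (le_trans ?_ (mk_ops_le_power F L 𝓛 h𝓛)) ?_
  · refine mk_le_of_surjective (f := fun x => ⟨_, opSym L x.2.2⟩) ?_
    rintro ⟨_, ⟨σ⟩⟩
    exact ⟨⟨_, _, σ⟩, rfl⟩
  · have hA : #(Action L) ≤ power F L 𝓛 :=
      Action.mk_le.trans (max_le (mk_labels_le_power F L 𝓛 h𝓛 s) h0)
    have hsum : #(S ⊕ Action L) ≤ power F L 𝓛 := by
      rw [mk_sum, lift_id, lift_id]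
      exact add_le_of_le h0 (mk_sorts_le_power F L 𝓛 h𝓛) hA
    refine le_trans (mk_le_of_surjective (f := fun x : S ⊕ Action L =>
      (Sum.elim (fun s => ⟨1, sortSym F L s⟩) (fun a => ⟨2, actSym F a⟩) x :
        Σ n, (lang F L).Relations n)) ?_) hsum
    rintro ⟨_, r⟩
    cases r with
    | sort s => exact ⟨.inl s, rfl⟩
    | act a => exact ⟨.inr a, rfl⟩

end TA

theorem theorem4 {S : Type u} (F : List S → S → Type u) (L : Type u) (𝓛 : TA.Fragment)
    (h𝓛 : 𝓛.ex) (A : TA.Model F L) (s : S)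
    (hs : TA.power F L 𝓛 ≤ Cardinal.mk (A.carrier s)) :
    ∃ B : TA.Submodel A, B.IsElementary 𝓛 ∧ Cardinal.mk (B.carrier s) = TA.power F L 𝓛 := by
  -- Placing `P` inside `H` forces at least `α` elements of sort `s`; the size of `H` bounds them by
  -- `α`.
  obtain ⟨P, hP⟩ := Cardinal.le_mk_iff_exists_set.1 hs
  have inj : Function.Injective (Sigma.mk s : A.carrier s → A.Total) := sigma_mk_injective
  obtain ⟨H, hPH, hH⟩ := FirstOrder.Language.exists_elementarySubstructure_card_eq
    (TA.lang F L) (Sigma.mk s '' P : Set A.Total) (TA.power F L 𝓛)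
    (TA.aleph0_le_power F L 𝓛 h𝓛 s)
    (by rw [Cardinal.mk_image_eq inj, hP])
    (by simpa using TA.card_lang_le_power F L 𝓛 h𝓛 s)
    (by simpa using hs.trans (Cardinal.mk_le_of_injective inj))
  refine ⟨TA.submodelOf H.toSubstructure, TA.isElementary_submodelOf H 𝓛, le_antisymm ?_ ?_⟩
  · rw [← Cardinal.lift_inj.1 hH]
    exact Cardinal.mk_le_of_injective (f := fun x => (⟨⟨s, x.1⟩, x.2⟩ : H)) fun x y h =>
      Subtype.ext (inj (congrArg Subtype.val h))
  · rw [← hP]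
    exact Cardinal.mk_le_mk_of_subset fun x hx => hPH ⟨x, hx, rfl⟩
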